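/- Let $(X(t))_{t\ge 0}$ be a Markov chain on a measurable space $\mathsf X$ with Markov kernel $P$, arbitrary initial distribution $\mu$, and let $\Pi$ be a probability measure with $\Pi P=\Pi$. Let $f=(f_1,\dots,f_d)^\top:\mathsf X\to\mathbb R^d$ be measurable and square integrable with respect to $\Pi$, write $\Pi f=\int f\,d\Pi$ and $M_n=n^{-1}\sum_{t=1}^n f(X(t))$, and let $H:\mathbb R^d\to\mathbb R^m$ ($m\ge 1$) be measurable and differentiable at $\Pi f$, with Jacobian matrix $D(H)$ at $\Pi f$. Suppose that for all $i,j$ the series $\sum_{t\ge1}\langle f_i-\Pi f_i,P^t(f_j-\Pi f_j)\rangle_{L^2(\Pi)}$ converges, let $\Sigma(f)$ be the $d\times d$ matrix with entries $$\sigma_{i,j}=\langle f_i-\Pi f_i,f_j-\Pi f_j\rangle_{L^2(\Pi)}+\sum_{t=1}^\infty\langle f_i-\Pi f_i,P^t(f_j-\Pi f_j)\rangle_{L^2(\Pi)}+\sum_{t=1}^\infty\langle f_j-\Pi f_j,P^t(f_i-\Pi f_i)\rangle_{L^2(\Pi)},$$ and let $V=D(H)\Sigma(f)D(H)^\top$ (possibly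 singular). For each $n$ let $V_n$ be a measurable function of $(X(1),\dots,X(n))$ with values in the positive semidefinite $m\times m$ matrices. Assume that, as $n\to\infty$, $$n^{1/2}\,[H(M_n)-H(\Pi f)]\Rightarrow N_m(0,V),\qquad V_n\xrightarrow{p}V .$$ Let $V_*$ be a positive definite $m\times m$ matrix, let $Y(1),Y(2),\dots$ be i.i.d. $N_m(0,V_*)$ random vectors, independent of the chain, and let $G_n=n^{-1}\sum_{t=1}^nY(t)$. Let $\varepsilon>0$ and $\alpha\in(0,1)$, and let $v_{n,i}$ be the $i$th diagonal entry of $V_n+\varepsilon^2V_*$. Then the equation $$N_m\Big(\prod_{i=1}^m\big[-\xi v_{n,i}^{1/2},\,\xi v_{n,i}^{1/2}\big];\,0,\;V_n+\varepsilon^2V_*\Big)=1-\alpha,$$ where $N_m(\cdot;a,B)$ is the measure given by the $N_m(a,B)$ distribution, has a unique positive solution $\xi=\xi_n(\alpha)$, and with $$J_{n,i}(\xi)=\Big[H(M_n)_i+\varepsilon G_{n,i}-\xi\sqrt{v_{n,i}/n},\;H(M_n)_i+\varepsilon G_{n,i}+\xi\sqrt{v_{n,i}/n}\Big],\qquad i=1,\dots,m,$$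 one has $$\lim_{n\to\infty}\Pr\Big(H(\Pi f)\in\prod_{i=1}^mJ_{n,i}(\xi_n(\alpha))\Big)=1-\alpha .$$ -/

import Mathlib

open MeasureTheory ProbabilityTheory Filter Matrix
open scoped Topology

noncomputable section

namespace NoisyMCMC

variable {Ω 𝒳 : Type*} [MeasurableSpace Ω] [MeasurableSpace 𝒳] {d m : ℕ}

/-- `X 0, X 1, …` is a Markov chain under `Pr` with initial distribution `μ` and transition
kernel `P`: the conditional law of `X (t + 1)` given `(X 0, …, X t)` is `P (X t)`. -/
structure IsMarkovChain (Pr : Measure Ω) (μ : Measure 𝒳) (P : Kernel 𝒳 𝒳)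
    (X : ℕ → Ω → 𝒳) : Prop where
  measurable : ∀ t, Measurable (X t)
  initial : HasLaw (X 0) μ Pr
  transition : ∀ t : ℕ, HasCondDistrib (X (t + 1)) (fun ω (s : Fin (t + 1)) => X s ω)
    (P.comap (fun h : Fin (t + 1) → 𝒳 => h (Fin.last t)) (measurable_pi_apply _)) Pr

/-- The average `n⁻¹ ∑_{t=1}^n Z t` of a sequence of random vectors. -/
def average (Z : ℕ → Ω → EuclideanSpace ℝ (Fin d)) (n : ℕ) (ω : Ω) :
    EuclideanSpace ℝ (Fin d) :=
  (n : ℝ)⁻¹ • ∑ t ∈ Finset.Icc 1 n, Z t ω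

/-- The vector of means `(π f₁, …, π f_d)`. -/
def meanVec (π : Measure 𝒳) (f : 𝒳 → EuclideanSpace ℝ (Fin d)) : EuclideanSpace ℝ (Fin d) :=
  WithLp.toLp 2 (fun i => ∫ x, f x i ∂π)

/-- The inner product `⟨f_i - π f_i, P^t (f_j - π f_j)⟩` in `L²(π)`. -/
def lagCov (P : Kernel 𝒳 𝒳) (π : Measure 𝒳) (f : 𝒳 → EuclideanSpace ℝ (Fin d)) (t : ℕ)
    (i j : Fin d) : ℝ :=
  ∫ x, (f x i - meanVec π f i) * (∫ y, (f y j - meanVec π f j) ∂((P ^ t) x)) ∂π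

/-- `S` is the asymptotic covariance matrix of the ergodic averages of `f`: the series
`∑_{t ≥ 1} ⟨f_i - π f_i, P^t (f_j - π f_j)⟩` converge, and `S i j` is
`⟨f_i - π f_i, f_j - π f_j⟩` plus the sum of this series and of the one with `i`, `j` swapped. -/
def IsAsymptoticCov (P : Kernel 𝒳 𝒳) (π : Measure 𝒳) (f : 𝒳 → EuclideanSpace ℝ (Fin d))
    (S : Matrix (Fin d) (Fin d) ℝ) : Prop :=
  ∃ L : Matrix (Fin d) (Fin d) ℝ,
    (∀ i j, Tendsto (fun T : ℕ => ∑ t ∈ Finset.Icc 1 T, lagCov P π f t i j) atTop (𝓝 (L i j))) ∧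
    ∀ i j, S i j =
      (∫ x, (f x i - meanVec π f i) * (f x j - meanVec π f j) ∂π) + L i j + L j i

/-- The matrix of partial derivatives of `H` at `η`. -/
def jacobian (H : EuclideanSpace ℝ (Fin d) → EuclideanSpace ℝ (Fin m))
    (η : EuclideanSpace ℝ (Fin d)) : Matrix (Fin m) (Fin d) ℝ :=
  Matrix.of fun i j => (fderiv ℝ H η (EuclideanSpace.single j 1)) i

/-- `ξ` is a positive solution of
`N_m(∏ i, [-ξ S_ii^{1/2}, ξ S_ii^{1/2}]; 0, S) = 1 - α`. -/
def IsCriticalValue (S : Matrix (Fin m) (Fin m) ℝ) (α ξ : ℝ) : Prop :=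
  0 < ξ ∧ (multivariateGaussian 0 S).real
    {x | ∀ i, x i ∈ Set.Icc (-(ξ * √(S i i))) (ξ * √(S i i))} = 1 - α

end NoisyMCMC

end

/-! Write `S = V + ε² V_*`. For `n ≥ 1` the scaled noise `√n ε G_n` has law exactly `N(0, ε² V_*)`
and is independent of `√n (H(M_n) - H(Πf))`, so their sum converges in law to `N(0, S)`
(`tendsto_law_add_noise`). The noise makes `S` positive definite even when `V` is singular.

For such a covariance, the distribution function `maxCDF` of `max |W_i| / S_ii^{1/2}` is continuous
and strictly increasing on `[0, ∞)`. Hence the critical value is unique and depends continuously on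
the matrix (`eventually_abs_criticalValue_sub_lt`). Consistency of `V_n` then makes the random
half-widths converge in probability to those of the limiting critical box
(`tendsto_measureReal_halfWidth`). Box faces are null for `N(0, S)`, so a Slutsky-type sandwich
(`tendsto_measureReal_abs_le`) gives the limiting coverage `1 - α`. -/

namespace NoisyMCMC

open scoped MatrixOrder

/-! ### Nondegenerate Gaussians: full support and null faces of boxes -/

section Gaussian

variable {m : ℕ} {S : Matrix (Fin m) (Fin m) ℝ}

/-- The symmetric box `∏ i, [-c i, c i]`. -/
def box (c : Fin m → ℝ) : Set (EuclideanSpace ℝ (Fin m)) :=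
  {x | ∀ i, x i ∈ Set.Icc (-(c i)) (c i)}

lemma mem_box {c : Fin m → ℝ} {x : EuclideanSpace ℝ (Fin m)} :
    x ∈ box c ↔ ∀ i, |x i| ≤ c i := by
  simp [box, abs_le]

lemma box_mono {c c' : Fin m → ℝ} (h : ∀ i, c i ≤ c' i) : box c ⊆ box c' := fun _ hx =>
  mem_box.2 fun i => (mem_box.1 hx i).trans (h i)

lemma isClosed_box (c : Fin m → ℝ) : IsClosed (box c) := by
  simp only [box, Set.ofPred_forall]
  exact isClosed_iInter fun i => isClosed_Icc.preimage (by fun_prop)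

lemma isOpenPosMeasure_gaussianReal {a : ℝ} {v : NNReal} (hv : v ≠ 0) :
    (gaussianReal a v).IsOpenPosMeasure :=
  (gaussianReal_absolutelyContinuous' a hv).isOpenPosMeasure

instance isOpenPosMeasure_stdGaussian :
    (stdGaussian (EuclideanSpace ℝ (Fin m))).IsOpenPosMeasure := by
  have := isOpenPosMeasure_gaussianReal (a := 0) (v := 1) one_ne_zero
  rw [← map_pi_eq_stdGaussian]
  exact (PiLp.continuous_toLp 2 _).isOpenPosMeasure_map (WithLp.toLp_surjective 2)

lemma isOpenPosMeasure_multivariateGaussian (hS : S.PosDef) :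
    (multivariateGaussian 0 S).IsOpenPosMeasure := by
  rw [multivariateGaussian]
  refine Continuous.isOpenPosMeasure_map (by fun_prop) ?_
  intro y
  have hu : IsUnit (CFC.sqrt S) := by
    have h := CFC.sqrt_mul_sqrt_self S hS.posSemidef.nonneg
    exact isUnit_of_mul_isUnit_left (h ▸ hS.isUnit)
  obtain ⟨u, hu⟩ := hu
  -- The square root of a positive definite matrix is invertible, so the linear map carrying the
  -- standard Gaussian to `N(0, S)` is onto.
  refine ⟨toEuclideanCLM (𝕜 := ℝ) (↑u⁻¹ : Matrix (Fin m) (Fin m) ℝ) y, ?_⟩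
  rw [← hu]
  simp only [zero_add]
  rw [← ContinuousLinearMap.comp_apply, ← ContinuousLinearMap.mul_def, ← map_mul]
  simp

lemma multivariateGaussian_abs_eq_null (hS : S.PosDef) (i : Fin m) (a : ℝ) :
    multivariateGaussian 0 S {x | |x i| = a} = 0 := by
  have hv : (S i i).toNNReal ≠ 0 := by simpa using hS.diag_pos (i := i)
  have := nullSingletonClass_gaussianReal (μ := (0 : EuclideanSpace ℝ (Fin m)) i) hv
  have hmp := measurePreserving_eval_multivariateGaussian (μ := 0) hS.posSemidef (i := i)
  have hfin : ({a, -a} : Set ℝ).Finite := by simp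
  refine measure_mono_null (t := (fun x => x i) ⁻¹' ({a, -a} : Set ℝ)) ?_ ?_
  · intro x hx
    obtain rfl : |x i| = a := hx
    rcases abs_choice (x i) with h | h <;> simp [h]
  · rw [hmp.measure_preimage hfin.measurableSet.nullMeasurableSet]
    exact hfin.measure_zero _

end Gaussian

/-! ### Convergence of the measures of boxes -/

section WeakConvergence

variable {m : ℕ}

lemma frontier_box_subset (c : Fin m → ℝ) :
    frontier (box c) ⊆ ⋃ i, {x : EuclideanSpace ℝ (Fin m) | |x i| = c i} := by
  intro x hx
  by_contra hne
  simp only [Set.mem_iUnion, Set.mem_ofPred_eq, not_exists] at hne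
  have hmem : x ∈ box c := (isClosed_box c).frontier_subset hx
  have hlt : ∀ i, |x i| < c i := fun i => lt_of_le_of_ne (mem_box.1 hmem i) (hne i)
  have hopen : IsOpen {x : EuclideanSpace ℝ (Fin m) | ∀ i, |x i| < c i} := by
    simp only [Set.ofPred_forall]
    exact isOpen_iInter_of_finite fun i => isOpen_lt (by fun_prop) continuous_const
  exact hx.2 (mem_interior.2 ⟨_, fun y hy => mem_box.2 fun i => (hy i).le, hopen, hlt⟩)

/-- Weak convergence gives convergence of the measures of boxes whose faces are null. -/
lemma tendsto_measureReal_box {ι : Type*} {l : Filter ι}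
    {μs : ι → ProbabilityMeasure (EuclideanSpace ℝ (Fin m))}
    {ν : ProbabilityMeasure (EuclideanSpace ℝ (Fin m))}
    (hν : ∀ i a, (ν : Measure (EuclideanSpace ℝ (Fin m))) {x | |x i| = a} = 0)
    (h : Tendsto μs l (𝓝 ν)) (c : Fin m → ℝ) :
    Tendsto (fun k => (μs k : Measure (EuclideanSpace ℝ (Fin m))).real (box c)) l
      (𝓝 ((ν : Measure (EuclideanSpace ℝ (Fin m))).real (box c))) := by
  refine (ENNReal.tendsto_toReal (measure_ne_top _ _)).comp
    (ProbabilityMeasure.tendsto_measure_of_null_frontier_of_tendsto' h ?_)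
  exact measure_mono_null (frontier_box_subset c) (measure_iUnion_null fun i => hν i _)

/-- Off the null faces of the limit box, membership in the moving box is eventually constant, so
dominated convergence applies to the indicators. -/
lemma tendsto_measureReal_box_of_tendsto {ι : Type*} {l : Filter ι} [l.IsCountablyGenerated]
    {ν : Measure (EuclideanSpace ℝ (Fin m))} [IsFiniteMeasure ν]
    (hν : ∀ i a, ν {x | |x i| = a} = 0) {c : ι → Fin m → ℝ} {c₀ : Fin m → ℝ}
    (hc : Tendsto c l (𝓝 c₀)) :
    Tendsto (fun k => ν.real (box (c k))) l (𝓝 (ν.real (box c₀))) := by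
  refine (ENNReal.tendsto_toReal (measure_ne_top _ _)).comp ?_
  refine tendsto_measure_of_ae_tendsto_indicator_of_isFiniteMeasure l
    (isClosed_box c₀).measurableSet (fun k => (isClosed_box (c k)).measurableSet) ?_
  have hae : ∀ᵐ x ∂ν, ∀ i, |x i| ≠ c₀ i := ae_all_iff.2 fun i => by
    simpa [ae_iff] using hν i (c₀ i)
  filter_upwards [hae] with x hx
  have hev : ∀ i, ∀ᶠ k in l, (|x i| ≤ c k i ↔ |x i| ≤ c₀ i) := by
    intro i
    have hci := tendsto_pi_nhds.1 hc i
    rcases lt_or_gt_of_ne (hx i) with h | h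
    · filter_upwards [hci.eventually_const_lt h] with k hk
      exact iff_of_true hk.le h.le
    · filter_upwards [hci.eventually_lt_const h] with k hk
      exact iff_of_false hk.not_ge h.not_ge
  filter_upwards [eventually_all.2 hev] with k hk
  simp only [mem_box]
  exact forall_congr' hk

/-- A sandwich principle: if `p k` is, up to a vanishing error, between the measures of the
slightly smaller and slightly larger boxes, then `p k` tends to the measure of the box. -/
lemma tendsto_of_box_sandwich {ι : Type*} {l : Filter ι}
    {μs : ι → ProbabilityMeasure (EuclideanSpace ℝ (Fin m))}
    {ν : ProbabilityMeasure (EuclideanSpace ℝ (Fin m))}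
    (hν : ∀ i a, (ν : Measure (EuclideanSpace ℝ (Fin m))) {x | |x i| = a} = 0)
    (h : Tendsto μs l (𝓝 ν)) (c : Fin m → ℝ) {p : ι → ℝ}
    (hp : ∀ δ > 0, ∃ e : ι → ℝ, Tendsto e l (𝓝 0) ∧ ∀ᶠ k in l,
      (μs k : Measure (EuclideanSpace ℝ (Fin m))).real (box fun i => c i - δ) - e k ≤ p k ∧
      p k ≤ (μs k : Measure (EuclideanSpace ℝ (Fin m))).real (box fun i => c i + δ) + e k) :
    Tendsto p l (𝓝 ((ν : Measure (EuclideanSpace ℝ (Fin m))).real (box c))) := by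
  set F : (Fin m → ℝ) → ℝ := fun c => (ν : Measure (EuclideanSpace ℝ (Fin m))).real (box c)
  have hF : Continuous F := continuous_iff_continuousAt.2 fun c₀ =>
    tendsto_measureReal_box_of_tendsto hν tendsto_id
  have hminus : Tendsto (fun δ : ℝ => F fun i => c i - δ) (𝓝[>] 0) (𝓝 (F c)) := by
    have : Continuous fun δ : ℝ => F fun i => c i - δ := hF.comp (by fun_prop)
    simpa using (this.tendsto 0).mono_left nhdsWithin_le_nhds
  have hplus : Tendsto (fun δ : ℝ => F fun i => c i + δ) (𝓝[>] 0) (𝓝 (F c)) := by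
    have : Continuous fun δ : ℝ => F fun i => c i + δ := hF.comp (by fun_prop)
    simpa using (this.tendsto 0).mono_left nhdsWithin_le_nhds
  -- First `δ` is fixed so that the perturbed limit box stays on the right side of `a`; only then
  -- does `k` go to the limit.
  refine tendsto_order.2 ⟨fun a ha => ?_, fun a ha => ?_⟩
  · obtain ⟨δ, hδ, hδ0⟩ := ((hminus.eventually_const_lt ha).and self_mem_nhdsWithin).exists
    obtain ⟨e, he, hev⟩ := hp δ hδ0
    have hlim := (tendsto_measureReal_box hν h fun i => c i - δ).sub he
    rw [sub_zero] at hlim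
    filter_upwards [hlim.eventually_const_lt hδ, hev] with k hk hk'
    exact hk.trans_le hk'.1
  · obtain ⟨δ, hδ, hδ0⟩ := ((hplus.eventually_lt_const ha).and self_mem_nhdsWithin).exists
    obtain ⟨e, he, hev⟩ := hp δ hδ0
    have hlim := (tendsto_measureReal_box hν h fun i => c i + δ).add he
    rw [add_zero] at hlim
    filter_upwards [hlim.eventually_lt_const hδ, hev] with k hk hk'
    exact hk'.2.trans_lt hk

end WeakConvergence

/-! ### Existence, uniqueness and continuity of the critical value -/

section CriticalValue

variable {m : ℕ} {S : Matrix (Fin m) (Fin m) ℝ}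

/-- The distribution function of `max i, |W i| / S_ii^{1/2}`, where `W` has law `N_m(0, S)`. -/
noncomputable def maxCDF (S : Matrix (Fin m) (Fin m) ℝ) (ξ : ℝ) : ℝ :=
  (multivariateGaussian 0 S).real (box fun i => ξ * √(S i i))

lemma isCriticalValue_iff {α ξ : ℝ} : IsCriticalValue S α ξ ↔ 0 < ξ ∧ maxCDF S ξ = 1 - α :=
  Iff.rfl

lemma maxCDF_monotone : Monotone (maxCDF S) := fun _ _ h =>
  measureReal_mono (box_mono fun _ => mul_le_mul_of_nonneg_right h (Real.sqrt_nonneg _))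

lemma continuous_maxCDF (hS : S.PosDef) : Continuous (maxCDF S) :=
  continuous_iff_continuousAt.2 fun ξ =>
    tendsto_measureReal_box_of_tendsto (multivariateGaussian_abs_eq_null hS)
      (Continuous.tendsto (by fun_prop) ξ)

/-- The degenerate box lies in a null hyperplane. A coordinate is needed: for `m = 0` the box is the
whole space. -/
lemma maxCDF_zero (hm : 0 < m) (hS : S.PosDef) : maxCDF S 0 = 0 := by
  rw [maxCDF, measureReal_eq_zero_iff]
  refine measure_mono_null (fun x hx => ?_) (multivariateGaussian_abs_eq_null hS ⟨0, hm⟩ 0)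
  simpa using mem_box.1 hx ⟨0, hm⟩

lemma tendsto_maxCDF_atTop (hS : S.PosDef) : Tendsto (maxCDF S) atTop (𝓝 1) := by
  have h1 : (1 : ℝ) = (multivariateGaussian 0 S).real Set.univ := by simp
  rw [h1]
  refine (ENNReal.tendsto_toReal (measure_ne_top _ _)).comp ?_
  refine tendsto_measure_of_ae_tendsto_indicator_of_isFiniteMeasure _
    MeasurableSet.univ (fun k => (isClosed_box _).measurableSet) ?_
  refine ae_of_all _ fun x => ?_
  have hev : ∀ i, ∀ᶠ ξ : ℝ in atTop, |x i| ≤ ξ * √(S i i) := fun i =>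
    (tendsto_id.atTop_mul_const (Real.sqrt_pos.2 hS.diag_pos)).eventually_ge_atTop _
  filter_upwards [eventually_all.2 hev] with ξ hξ
  simpa [mem_box] using hξ

/-- Between the two boxes lies a nonempty open set, which a measure of full support charges. -/
lemma strictMonoOn_maxCDF (hm : 0 < m) (hS : S.PosDef) :
    StrictMonoOn (maxCDF S) (Set.Ici 0) := by
  intro a ha b hb hab
  have := isOpenPosMeasure_multivariateGaussian hS
  have hs : ∀ i, 0 < √(S i i) := fun i => Real.sqrt_pos.2 hS.diag_pos
  have ha : 0 ≤ a := ha
  set U : Set (EuclideanSpace ℝ (Fin m)) :=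
    {x | (∀ i, |x i| < b * √(S i i)) ∧ a * √(S ⟨0, hm⟩ ⟨0, hm⟩) < |x ⟨0, hm⟩|} with hU
  have hUo : IsOpen U := by
    rw [hU, Set.ofPred_and, Set.ofPred_forall]
    exact (isOpen_iInter_of_finite fun i => isOpen_lt (by fun_prop) continuous_const).inter
      (isOpen_lt continuous_const (by fun_prop))
  have hne : U.Nonempty := by
    refine ⟨WithLp.toLp 2 fun i => (a + b) / 2 * √(S i i), fun i => ?_, ?_⟩
    · simp only [abs_mul, abs_of_pos (hs i), abs_of_pos (show 0 < (a + b) / 2 by linarith)]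
      exact mul_lt_mul_of_pos_right (by linarith) (hs i)
    · simp only [abs_mul, abs_of_pos (hs _), abs_of_pos (show 0 < (a + b) / 2 by linarith)]
      exact mul_lt_mul_of_pos_right (by linarith) (hs _)
  have hpos : 0 < (multivariateGaussian 0 S).real U :=
    ENNReal.toReal_pos (hUo.measure_pos _ hne).ne' (measure_ne_top _ _)
  have hdisj : Disjoint (box fun i => a * √(S i i)) U :=
    Set.disjoint_left.2 fun x hx hxU => (mem_box.1 hx _).not_gt hxU.2
  have hsub : (box fun i => a * √(S i i)) ∪ U ⊆ box fun i => b * √(S i i) :=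
    Set.union_subset (box_mono fun i => mul_le_mul_of_nonneg_right hab.le (hs i).le)
      fun x hx => mem_box.2 fun i => (hx.1 i).le
  have hle := measureReal_mono (μ := multivariateGaussian 0 S) hsub
  rw [measureReal_union hdisj hUo.measurableSet] at hle
  exact (lt_add_of_pos_right _ hpos).trans_le hle

lemma existsUnique_isCriticalValue (hm : 0 < m) (hS : S.PosDef) {α : ℝ}
    (hα : α ∈ Set.Ioo (0 : ℝ) 1) : ∃! ξ : ℝ, IsCriticalValue S α ξ := by
  obtain ⟨b, hb, hb0⟩ := (((tendsto_maxCDF_atTop hS).eventually_const_lt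
    (show 1 - α < 1 by linarith [hα.1])).and (eventually_ge_atTop 0)).exists
  obtain ⟨ξ, hξ, hξα⟩ := intermediate_value_Icc hb0 (continuous_maxCDF hS).continuousOn
    (show 1 - α ∈ Set.Icc (maxCDF S 0) (maxCDF S b) from
      ⟨by rw [maxCDF_zero hm hS]; linarith [hα.2], hb.le⟩)
  have hξ0 : ξ ≠ 0 := by
    rintro rfl
    rw [maxCDF_zero hm hS] at hξα
    linarith [hα.2]
  refine ⟨ξ, ⟨lt_of_le_of_ne hξ.1 hξ0.symm, hξα⟩, fun η hη => ?_⟩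
  exact (strictMonoOn_maxCDF hm hS).injOn hη.1.le hξ.1 (hη.2.trans hξα.symm)

lemma tendsto_multivariateGaussian {T : ℕ → Matrix (Fin m) (Fin m) ℝ}
    (hT : ∀ k, (T k).PosSemidef) (hS : S.PosSemidef) (h : Tendsto T atTop (𝓝 S)) :
    Tendsto (β := ProbabilityMeasure (EuclideanSpace ℝ (Fin m)))
      (fun k => ⟨multivariateGaussian 0 (T k), inferInstance⟩) atTop
      (𝓝 ⟨multivariateGaussian 0 S, inferInstance⟩) := by
  refine ProbabilityMeasure.tendsto_of_tendsto_charFun fun t => ?_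
  simp only [ProbabilityMeasure.coe_mk, charFun_multivariateGaussian (hT _),
    charFun_multivariateGaussian hS]
  have hc : Continuous fun M : Matrix (Fin m) (Fin m) ℝ =>
      Complex.exp (inner ℝ t (0 : EuclideanSpace ℝ (Fin m)) * Complex.I
        - ((t.ofLp ⬝ᵥ M *ᵥ t.ofLp : ℝ) : ℂ) / 2) := by
    fun_prop
  exact (hc.tendsto S).comp h

/-- Law and box vary together: the laws converge weakly, and the change in half-widths is absorbed
by the `δ` of the sandwich with zero error. -/
lemma tendsto_maxCDF {T : ℕ → Matrix (Fin m) (Fin m) ℝ}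
    (hT : ∀ k, (T k).PosDef) (hS : S.PosDef) (h : Tendsto T atTop (𝓝 S)) (ξ : ℝ) :
    Tendsto (fun k => maxCDF (T k) ξ) atTop (𝓝 (maxCDF S ξ)) := by
  refine tendsto_of_box_sandwich (multivariateGaussian_abs_eq_null hS)
    (tendsto_multivariateGaussian (fun k => (hT k).posSemidef) hS.posSemidef h) _
    fun δ hδ => ⟨fun _ => 0, tendsto_const_nhds, ?_⟩
  have hev : ∀ i, ∀ᶠ k in atTop, |ξ * √(T k i i) - ξ * √(S i i)| < δ := fun i => by
    have hc : Continuous fun M : Matrix (Fin m) (Fin m) ℝ => ξ * √(M i i) := by fun_prop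
    exact (((hc.tendsto S).comp h).eventually (Metric.ball_mem_nhds _ hδ))
  filter_upwards [eventually_all.2 hev] with k hk
  rw [sub_zero, add_zero]
  simp only [ProbabilityMeasure.coe_mk]
  exact ⟨measureReal_mono (box_mono fun i => by linarith [abs_lt.1 (hk i)]),
    measureReal_mono (box_mono fun i => by linarith [(abs_lt.1 (hk i)).2])⟩

lemma continuousWithinAt_maxCDF (hS : S.PosDef) (ξ : ℝ) :
    ContinuousWithinAt (fun M => maxCDF M ξ) {M : Matrix (Fin m) (Fin m) ℝ | M.PosDef} S := by
  have : (𝓝[{M : Matrix (Fin m) (Fin m) ℝ | M.PosDef}] S).IsCountablyGenerated := by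
    have : FirstCountableTopology (Matrix (Fin m) (Fin m) ℝ) :=
      inferInstanceAs (FirstCountableTopology (Fin m → Fin m → ℝ))
    infer_instance
  refine tendsto_of_subseq_tendsto fun T hT => ?_
  obtain ⟨hT1, hT2⟩ := tendsto_nhdsWithin_iff.1 hT
  obtain ⟨N, hN⟩ := eventually_atTop.1 hT2
  -- The sequence is positive definite only from some index `N` on, hence the shift.
  exact ⟨fun k => k + N, tendsto_maxCDF (fun k => hN _ (by omega)) hS
    ((tendsto_add_atTop_iff_nat N).2 hT1) ξ⟩

/-- The critical value depends continuously on the positive definite covariance matrix. -/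
lemma eventually_abs_criticalValue_sub_lt (hm : 0 < m) (hS : S.PosDef) {α ξ₀ : ℝ}
    (hξ₀ : IsCriticalValue S α ξ₀) {η : ℝ} (hη : 0 < η) :
    ∀ᶠ M in 𝓝[{M : Matrix (Fin m) (Fin m) ℝ | M.PosDef}] S,
      ∀ ξ, IsCriticalValue M α ξ → |ξ - ξ₀| < η := by
  obtain ⟨h0, h1⟩ := isCriticalValue_iff.1 hξ₀
  have hmono := strictMonoOn_maxCDF hm hS
  -- The bound `r ≤ ξ₀` keeps `ξ₀ - r` in `[0, ∞)`, where strict monotonicity holds.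
  set r := min (η / 2) ξ₀
  have hr : 0 < r := lt_min (by linarith) h0
  have hrη : r < η := (min_le_left _ _).trans_lt (by linarith)
  have hrξ : r ≤ ξ₀ := min_le_right _ _
  have hlo : maxCDF S (ξ₀ - r) < 1 - α := h1 ▸ hmono (by simpa using hrξ) h0.le (by linarith)
  have hhi : 1 - α < maxCDF S (ξ₀ + r) :=
    h1 ▸ hmono h0.le (show 0 ≤ ξ₀ + r by linarith) (by linarith)
  filter_upwards [(continuousWithinAt_maxCDF hS _).eventually_lt_const hlo,
    (continuousWithinAt_maxCDF hS _).eventually_const_lt hhi] with M hM1 hM2 ξ hξ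
  rw [← hξ.2] at hM1 hM2
  have h3 := maxCDF_monotone.reflect_lt hM1
  have h4 := maxCDF_monotone.reflect_lt hM2
  rw [abs_lt]
  constructor <;> linarith

end CriticalValue

lemma average_eq_sum_range {Ω : Type*} {d : ℕ} (Z : ℕ → Ω → EuclideanSpace ℝ (Fin d))
    (n : ℕ) (ω : Ω) :
    average Z n ω = (n : ℝ)⁻¹ • ∑ t ∈ Finset.range n, Z (t + 1) ω := by
  rw [average, Finset.range_eq_Ico, Finset.sum_Ico_add' (fun t => Z t ω) 0 n 1]
  rfl

/-! ### Adding the noise, and boxes with random half-widths -/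

section Probability

variable {Ω : Type*} [MeasurableSpace Ω] {Pr : Measure Ω} {m : ℕ}

/-- The characteristic function of the rescaled average of iid centred Gaussian vectors. -/
lemma charFun_map_sqrt_smul_average {W : Matrix (Fin m) (Fin m) ℝ} (hW : W.PosSemidef)
    {Y : ℕ → Ω → EuclideanSpace ℝ (Fin m)}
    (hY_law : ∀ t, HasLaw (Y (t + 1)) (multivariateGaussian 0 W) Pr)
    (hY_indep : iIndepFun (fun t => Y (t + 1)) Pr) (ε : ℝ) {n : ℕ} (hn : n ≠ 0) :
    charFun (Pr.map fun ω => √(n : ℝ) • ε • average Y n ω) =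
      charFun (multivariateGaussian 0 (ε ^ 2 • W)) := by
  ext t
  have hn0 : (0 : ℝ) < n := by positivity
  have hsum : (fun ω => √(n : ℝ) • ε • average Y n ω) =
      fun ω => (√(n : ℝ) * ε * (n : ℝ)⁻¹) • (∑ t ∈ Finset.range n, fun ω => Y (t + 1) ω) ω := by
    ext1 ω
    rw [average_eq_sum_range, smul_smul, smul_smul, Finset.sum_apply]
  have hmeas : AEMeasurable (∑ t ∈ Finset.range n, fun ω => Y (t + 1) ω) Pr :=
    Finset.aemeasurable_sum _ fun t _ => (hY_law t).aemeasurable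
  have hW' : (ε ^ 2 • W).PosSemidef := hW.smul (sq_nonneg ε)
  have hind : iIndepFun ((Finset.range n).restrict fun t ω => Y (t + 1) ω) Pr :=
    iIndepFun.precomp (g := ((↑) : Finset.range n → ℕ)) Subtype.val_injective hY_indep
  rw [hsum, charFun_map_smul_comp hmeas,
    hind.charFun_map_finsetSum_eq_prod fun t _ => (hY_law t).aemeasurable,
    charFun_multivariateGaussian hW']
  simp only [(hY_law _).map_eq, Finset.prod_const, Finset.card_range, Pi.pow_apply,
    charFun_multivariateGaussian hW, ← Complex.exp_nat_mul]
  congr 1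
  have hsq : (√(n : ℝ)) ^ 2 = n := Real.sq_sqrt hn0.le
  have hr : n * (√(n : ℝ) * ε * (n : ℝ)⁻¹) ^ 2 = ε ^ 2 := by
    rw [mul_pow, mul_pow, hsq]
    field_simp
  simp only [inner_zero_right, WithLp.ofLp_smul, mulVec_smul, smul_mulVec, smul_dotProduct,
    dotProduct_smul, smul_eq_mul, ← hr]
  push_cast
  ring

variable [IsProbabilityMeasure Pr]

/-- Entrywise convergence in probability of random matrices to a constant matrix. -/
lemma tendsto_measureReal_notMem_nhds {Vn : ℕ → Ω → Matrix (Fin m) (Fin m) ℝ}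
    {V : Matrix (Fin m) (Fin m) ℝ}
    (h : ∀ i j, TendstoInMeasure Pr (fun n ω => Vn n ω i j) atTop (fun _ => V i j))
    {U : Set (Matrix (Fin m) (Fin m) ℝ)} (hU : U ∈ 𝓝 V) :
    Tendsto (fun n => Pr.real {ω | Vn n ω ∉ U}) atTop (𝓝 0) := by
  -- Matrices are read as functions with the sup metric, whose balls are controlled entrywise; a
  -- union bound over entries follows.
  obtain ⟨r, hr, hball⟩ := Metric.mem_nhds_iff (α := Fin m → Fin m → ℝ).1 hU
  have hsum : Tendsto (fun n => ∑ i, ∑ j,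
      Pr.real {ω | ENNReal.ofReal r ≤ edist (Vn n ω i j) (V i j)})
      atTop (𝓝 0) := by
    have h0 : ∀ i j, Tendsto
        (fun n => Pr.real {ω | ENNReal.ofReal r ≤ edist (Vn n ω i j) (V i j)}) atTop (𝓝 0) :=
      fun i j =>
        (ENNReal.tendsto_toReal ENNReal.zero_ne_top).comp (h i j _ (ENNReal.ofReal_pos.2 hr))
    simpa using tendsto_finsetSum Finset.univ fun i _ =>
      tendsto_finsetSum Finset.univ fun j _ => h0 i j
  refine squeeze_zero (fun _ => measureReal_nonneg) (fun n => ?_) hsum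
  have hsub : {ω | Vn n ω ∉ U} ⊆
      ⋃ i, ⋃ j, {ω | ENNReal.ofReal r ≤ edist (Vn n ω i j) (V i j)} := by
    intro ω hω
    by_contra hne
    simp only [Set.mem_iUnion, Set.mem_ofPred_eq, not_exists, not_le] at hne
    refine hω (hball ?_)
    refine Metric.mem_ball.2 ((dist_pi_lt_iff hr).2 fun i => (dist_pi_lt_iff hr).2 fun j => ?_)
    have := hne i j
    rwa [edist_dist, ENNReal.ofReal_lt_ofReal_iff hr] at this
  calc Pr.real {ω | Vn n ω ∉ U} ≤ _ := measureReal_mono hsub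
    _ ≤ _ := (measureReal_iUnion_fintype_le _).trans
      (Finset.sum_le_sum fun i _ => measureReal_iUnion_fintype_le _)

/-- A limit in probability of positive semidefinite matrices is positive semidefinite. -/
lemma posSemidef_of_tendstoInMeasure {Vn : ℕ → Ω → Matrix (Fin m) (Fin m) ℝ}
    {V : Matrix (Fin m) (Fin m) ℝ} (hVn : ∀ n ω, (Vn n ω).PosSemidef)
    (h : ∀ i j, TendstoInMeasure Pr (fun n ω => Vn n ω i j) atTop (fun _ => V i j)) :
    V.PosSemidef := by
  have hclosed : IsClosed {M : Matrix (Fin m) (Fin m) ℝ | M.PosSemidef} := by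
    simp only [Matrix.posSemidef_iff_dotProduct_mulVec, Set.ofPred_and, Set.ofPred_forall]
    refine IsClosed.inter ?_ (isClosed_iInter fun x => ?_)
    · exact isClosed_eq (by fun_prop) continuous_id
    · exact isClosed_le continuous_const (by fun_prop)
  by_contra hV
  -- The complement of the closed cone would be a neighbourhood of `V` that `Vn` never enters, so a
  -- constant probability `1` would tend to `0`.
  have := tendsto_measureReal_notMem_nhds h (hclosed.isOpen_compl.mem_nhds hV)
  simp [hVn] at this

/-- Adding independent centred Gaussian noise to an asymptotically normal sequence. -/
lemma tendsto_law_add_noise {V W : Matrix (Fin m) (Fin m) ℝ} (hV : V.PosSemidef)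
    (hW : W.PosSemidef) {A B : ℕ → Ω → EuclideanSpace ℝ (Fin m)}
    (hA : TendstoInDistribution A atTop id (fun _ => Pr) (multivariateGaussian 0 V))
    (hBm : ∀ n, AEMeasurable (B n) Pr)
    (hB : ∀ᶠ n in atTop, charFun (Pr.map (B n)) = charFun (multivariateGaussian 0 W))
    (hAB : ∀ n, IndepFun (A n) (B n) Pr) :
    TendstoInDistribution (fun n ω => A n ω + B n ω) atTop id (fun _ => Pr)
      (multivariateGaussian 0 (V + W)) := by
  refine ⟨fun n => (hA.forall_aemeasurable n).add (hBm n), aemeasurable_id, ?_⟩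
  have hA' := ProbabilityMeasure.tendsto_iff_tendsto_charFun.1 hA.tendsto
  refine ProbabilityMeasure.tendsto_of_tendsto_charFun fun t => ?_
  have hlim := (hA' t).mul_const (charFun (multivariateGaussian 0 W) t)
  simp only [ProbabilityMeasure.coe_mk, Measure.map_id] at hlim ⊢
  have hprod : charFun (multivariateGaussian 0 (V + W)) t =
      charFun (multivariateGaussian 0 V) t * charFun (multivariateGaussian 0 W) t := by
    rw [charFun_multivariateGaussian hV, charFun_multivariateGaussian hW,
      charFun_multivariateGaussian (hV.add hW), ← Complex.exp_add, add_mulVec, dotProduct_add]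
    simp only [inner_zero_right]
    push_cast
    ring_nf
  rw [hprod]
  refine hlim.congr' ?_
  filter_upwards [hB] with n hn
  rw [(hAB n).charFun_map_fun_add_eq_mul (hA.forall_aemeasurable n) (hBm n), Pi.mul_apply, hn]

/-- Asymptotic coverage of a box with random half-widths converging in probability. -/
lemma tendsto_measureReal_abs_le {S : Matrix (Fin m) (Fin m) ℝ} (hS : S.PosDef)
    {Z : ℕ → Ω → EuclideanSpace ℝ (Fin m)}
    (hZ : TendstoInDistribution Z atTop id (fun _ => Pr) (multivariateGaussian 0 S))
    {b : ℕ → Ω → Fin m → ℝ} {b₀ : Fin m → ℝ}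
    (hb : ∀ δ > 0, Tendsto (fun n => Pr.real {ω | ¬ ∀ i, |b n ω i - b₀ i| < δ}) atTop (𝓝 0)) :
    Tendsto (fun n => Pr.real {ω | ∀ i, |Z n ω i| ≤ b n ω i}) atTop
      (𝓝 ((multivariateGaussian 0 S).real (box b₀))) := by
  have hlim := hZ.tendsto
  simp only [Measure.map_id] at hlim
  refine tendsto_of_box_sandwich (multivariateGaussian_abs_eq_null hS) hlim b₀ fun δ hδ =>
    ⟨_, hb δ hδ, Eventually.of_forall fun n => ?_⟩
  have hmap : ∀ c : Fin m → ℝ, (Pr.map (Z n)).real (box c) = Pr.real {ω | ∀ i, |Z n ω i| ≤ c i} :=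
    fun c => by
      rw [map_measureReal_apply_of_aemeasurable (hZ.forall_aemeasurable n)
        (isClosed_box c).measurableSet]
      congr 1
      ext ω
      exact mem_box
  simp only [ProbabilityMeasure.coe_mk, hmap]
  -- Only monotonicity and subadditivity of the measure are used, so the random half-widths need not
  -- be measurable.
  constructor
  · rw [sub_le_iff_le_add]
    refine (measureReal_mono fun ω hω => ?_).trans (measureReal_union_le _ _)
    by_cases h : ∀ i, |b n ω i - b₀ i| < δ
    · exact Or.inl fun i => (hω i).trans (by linarith [(abs_lt.1 (h i)).1])
    · exact Or.inr h
  · refine (measureReal_mono fun ω hω => ?_).trans (measureReal_union_le _ _)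
    by_cases h : ∀ i, |b n ω i - b₀ i| < δ
    · exact Or.inl fun i => (hω i).trans (by linarith [(abs_lt.1 (h i)).2])
    · exact Or.inr h

/-- Half-widths built from consistently estimated covariance matrices are consistent. -/
lemma tendsto_measureReal_halfWidth {S : Matrix (Fin m) (Fin m) ℝ} (hm : 0 < m) (hS : S.PosDef)
    {Vn : ℕ → Ω → Matrix (Fin m) (Fin m) ℝ} {V W : Matrix (Fin m) (Fin m) ℝ} (hVW : S = V + W)
    (hpd : ∀ n ω, (Vn n ω + W).PosDef)
    (h : ∀ i j, TendstoInMeasure Pr (fun n ω => Vn n ω i j) atTop (fun _ => V i j))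
    {α ξ₀ : ℝ} (hξ₀ : IsCriticalValue S α ξ₀) {ξ : ℕ → Ω → ℝ}
    (hξ : ∀ n ω, IsCriticalValue (Vn n ω + W) α (ξ n ω)) {δ : ℝ} (hδ : 0 < δ) :
    Tendsto (fun n => Pr.real {ω | ¬ ∀ i,
      |ξ n ω * √((Vn n ω + W) i i) - ξ₀ * √(S i i)| < δ}) atTop (𝓝 0) := by
  set D : Set (Matrix (Fin m) (Fin m) ℝ) := {M | M.PosDef} with hD
  have hwidth : ∀ᶠ M in 𝓝[D] S, ∀ i, ∀ x, IsCriticalValue M α x →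
      |x * √(M i i) - ξ₀ * √(S i i)| < δ := by
    refine eventually_all.2 fun i => ?_
    have hc : Tendsto (fun p : ℝ × Matrix (Fin m) (Fin m) ℝ => p.1 * √(p.2 i i))
        (𝓝 ξ₀ ×ˢ 𝓝[D] S) (𝓝 (ξ₀ * √(S i i))) := by
      have hcont : Continuous fun p : ℝ × Matrix (Fin m) (Fin m) ℝ => p.1 * √(p.2 i i) := by
        fun_prop
      refine (hcont.tendsto (ξ₀, S)).mono_left ?_
      rw [nhds_prod_eq]
      exact Filter.prod_mono le_rfl nhdsWithin_le_nhds
    obtain ⟨p, hp, q, hq, hpq⟩ := eventually_prod_iff.1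
      (hc.eventually (Metric.ball_mem_nhds _ hδ))
    obtain ⟨η, hη, hηp⟩ := Metric.eventually_nhds_iff.1 hp
    filter_upwards [hq, eventually_abs_criticalValue_sub_lt hm hS hξ₀ hη] with M hM hM' x hx
    exact hpq (hηp (hM' x hx)) hM
  -- Positive definiteness becomes a premise inside a full neighbourhood of `S`, which pulls back to
  -- a neighbourhood of `V` under `M ↦ M + W`.
  rw [eventually_nhdsWithin_iff] at hwidth
  have hadd : Tendsto (fun M => M + W) (𝓝 V) (𝓝 S) := by
    rw [hVW]
    exact (continuous_id.add continuous_const).tendsto V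
  refine squeeze_zero (fun _ => measureReal_nonneg) (fun n => measureReal_mono ?_)
    (tendsto_measureReal_notMem_nhds h (hadd hwidth))
  intro ω hω hU
  exact hω fun i => hU (hpd n ω) i _ (hξ n ω)

end Probability

end NoisyMCMC

/-! ### Asymptotic joint coverage -/

theorem proposition10
    {Ω 𝒳 : Type*} [MeasurableSpace Ω] [MeasurableSpace 𝒳]
    (Pr : Measure Ω) [IsProbabilityMeasure Pr]
    -- the chain, its kernel, its stationary distribution and its initial distribution
    (P : Kernel 𝒳 𝒳) [IsMarkovKernel P]
    (π : Measure 𝒳) [IsProbabilityMeasure π] (hπ : Kernel.Invariant P π)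
    (μ : Measure 𝒳) (X : ℕ → Ω → 𝒳) (hX : NoisyMCMC.IsMarkovChain Pr μ P X)
    -- the functions `f = (f₁, …, f_d)` and `H`
    {d m : ℕ} (hm : 0 < m)
    (f : 𝒳 → EuclideanSpace ℝ (Fin d)) (hf_meas : Measurable f) (hf : MemLp f 2 π)
    (H : EuclideanSpace ℝ (Fin d) → EuclideanSpace ℝ (Fin m)) (hH_meas : Measurable H)
    (hH : DifferentiableAt ℝ H (NoisyMCMC.meanVec π f))
    -- the asymptotic covariance matrix `V = D(H) Σ(f) D(H)ᵀ`
    (S : Matrix (Fin d) (Fin d) ℝ) (hS : NoisyMCMC.IsAsymptoticCov P π f S)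
    (V : Matrix (Fin m) (Fin m) ℝ)
    (hV : V = NoisyMCMC.jacobian H (NoisyMCMC.meanVec π f) * S *
      (NoisyMCMC.jacobian H (NoisyMCMC.meanVec π f))ᵀ)
    -- the estimator `V_n` of `V`, a function of `(X 1, …, X n)`
    (Vhat : (n : ℕ) → (Fin n → 𝒳) → Matrix (Fin m) (Fin m) ℝ)
    (hVhat_meas : ∀ n i j, Measurable (fun x => Vhat n x i j))
    (hVhat_psd : ∀ n x, (Vhat n x).PosSemidef)
    (Vn : ℕ → Ω → Matrix (Fin m) (Fin m) ℝ)
    (hVn : ∀ n ω, Vn n ω = Vhat n (fun t : Fin n => X (t + 1) ω))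
    -- the estimator `H(M_n)` of `H(π f)`
    (Hn : ℕ → Ω → EuclideanSpace ℝ (Fin m))
    (hHn : ∀ n ω, Hn n ω = H (NoisyMCMC.average (fun t ω => f (X t ω)) n ω))
    -- asymptotic normality and consistency
    (h_clt : TendstoInDistribution
      (fun (n : ℕ) ω => √(n : ℝ) • (Hn n ω - H (NoisyMCMC.meanVec π f)))
      atTop id (fun _ => Pr) (multivariateGaussian 0 V))
    (h_cons : ∀ i j, TendstoInMeasure Pr (fun n ω => Vn n ω i j) atTop (fun _ => V i j))
    -- the injected noise: `Y 1, Y 2, …` are iid `N_m(0, V_*)` and independent of the chain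
    (Vstar : Matrix (Fin m) (Fin m) ℝ) (hVstar : Vstar.PosDef)
    (Y : ℕ → Ω → EuclideanSpace ℝ (Fin m))
    (hY_law : ∀ t, HasLaw (Y (t + 1)) (multivariateGaussian 0 Vstar) Pr)
    (hY_indep : iIndepFun (fun t => Y (t + 1)) Pr)
    (hXY : IndepFun (fun ω t => X t ω) (fun ω t => Y (t + 1) ω) Pr)
    (ε : ℝ) (hε : 0 < ε) (α : ℝ) (hα : α ∈ Set.Ioo (0 : ℝ) 1) :
    -- the critical value is well defined
    (∀ n ω, ∃! ξ : ℝ, NoisyMCMC.IsCriticalValue (Vn n ω + ε ^ 2 • Vstar) α ξ) ∧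
    -- the joint coverage probability of the intervals tends to `1 - α`
    ∀ ξ : ℕ → Ω → ℝ,
      (∀ n ω, NoisyMCMC.IsCriticalValue (Vn n ω + ε ^ 2 • Vstar) α (ξ n ω)) →
      Tendsto (fun n : ℕ => Pr.real {ω | ∀ i,
          H (NoisyMCMC.meanVec π f) i ∈ Set.Icc
            (Hn n ω i + ε * NoisyMCMC.average Y n ω i
              - ξ n ω * √((Vn n ω + ε ^ 2 • Vstar) i i / n))
            (Hn n ω i + ε * NoisyMCMC.average Y n ω i
              + ξ n ω * √((Vn n ω + ε ^ 2 • Vstar) i i / n))})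
        atTop (𝓝 (1 - α)) := by
  have hVpsd : V.PosSemidef :=
    NoisyMCMC.posSemidef_of_tendstoInMeasure (fun n ω => hVn n ω ▸ hVhat_psd n _) h_cons
  have hWpd : (ε ^ 2 • Vstar).PosDef := hVstar.smul (pow_pos hε 2)
  have hSpd : (V + ε ^ 2 • Vstar).PosDef := PosDef.posSemidef_add hVpsd hWpd
  have hpd : ∀ n ω, (Vn n ω + ε ^ 2 • Vstar).PosDef := fun n ω =>
    PosDef.posSemidef_add (hVn n ω ▸ hVhat_psd n _) hWpd
  refine ⟨fun n ω => NoisyMCMC.existsUnique_isCriticalValue hm (hpd n ω) hα, fun ξ hξ => ?_⟩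
  obtain ⟨ξ₀, hξ₀, -⟩ := NoisyMCMC.existsUnique_isCriticalValue hm hSpd hα
  have hindep : ∀ n : ℕ, IndepFun
      (fun ω => √(n : ℝ) • (Hn n ω - H (NoisyMCMC.meanVec π f)))
      (fun ω => √(n : ℝ) • ε • NoisyMCMC.average Y n ω) Pr := by
    intro n
    -- Both vectors are measurable functions of the whole paths of the chain and of the noise, so
    -- independence of the paths passes to them.
    have hφ : Measurable fun x : ℕ → 𝒳 => √(n : ℝ) •
        (H ((n : ℝ)⁻¹ • ∑ t ∈ Finset.Icc 1 n, f (x t)) - H (NoisyMCMC.meanVec π f)) := by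
      have hf_meas' : ∀ t : ℕ, Measurable fun x : ℕ → 𝒳 => f (x t) := fun t =>
        hf_meas.comp (measurable_pi_apply t)
      fun_prop
    have hψ : Measurable fun y : ℕ → EuclideanSpace ℝ (Fin m) => √(n : ℝ) • ε •
        ((n : ℝ)⁻¹ • ∑ t ∈ Finset.range n, y t) := by
      fun_prop
    have hcomp := hXY.comp hφ hψ
    simp only [hHn, NoisyMCMC.average_eq_sum_range Y]
    exact hcomp
  have hnoise : ∀ n : ℕ, AEMeasurable (fun ω => √(n : ℝ) • ε • NoisyMCMC.average Y n ω) Pr := by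
    intro n
    simp only [NoisyMCMC.average_eq_sum_range]
    have hY_meas : ∀ t, AEMeasurable (Y (t + 1)) Pr := fun t => (hY_law t).aemeasurable
    fun_prop
  have hclt := NoisyMCMC.tendsto_law_add_noise hVpsd hWpd.posSemidef h_clt hnoise
    ((eventually_ne_atTop 0).mono fun n hn =>
      NoisyMCMC.charFun_map_sqrt_smul_average hVstar.posSemidef hY_law hY_indep ε hn) hindep
  have hlim := NoisyMCMC.tendsto_measureReal_abs_le hSpd hclt fun δ hδ =>
    NoisyMCMC.tendsto_measureReal_halfWidth hm hSpd rfl hpd h_cons hξ₀ hξ hδ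
  rw [show (multivariateGaussian 0 (V + ε ^ 2 • Vstar)).real
    (NoisyMCMC.box fun i => ξ₀ * √((V + ε ^ 2 • Vstar) i i)) = 1 - α from hξ₀.2] at hlim
  refine hlim.congr' ?_
  filter_upwards [eventually_ne_atTop 0] with n hn
  congr 1
  ext ω
  refine forall_congr' fun i => ?_
  have hn0 : (0 : ℝ) < √(n : ℝ) := Real.sqrt_pos.2 (by positivity)
  rw [Real.sqrt_div' _ (Nat.cast_nonneg n), abs_le, Set.mem_Icc]
  simp only [PiLp.add_apply, PiLp.smul_apply, PiLp.sub_apply, smul_eq_mul]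
  set h := H (NoisyMCMC.meanVec π f) i
  set g := NoisyMCMC.average Y n ω i
  set a := Hn n ω i
  set c := √((Vn n ω + ε ^ 2 • Vstar) i i)
  -- For `n ≠ 0`, cancelling `√n` turns the bound on the scaled error into membership in the
  -- interval.
  have hc : ξ n ω * c = √(n : ℝ) * (ξ n ω * (c / √(n : ℝ))) := by field_simp
  rw [hc, show √(n : ℝ) * (a - h) + √(n : ℝ) * (ε * g) = √(n : ℝ) * (a - h + ε * g) by ring,
    ← mul_neg, mul_le_mul_iff_right₀ hn0, mul_le_mul_iff_right₀ hn0]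
  constructor <;> rintro ⟨h1, h2⟩ <;> constructor <;> linarith
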